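/- A \emph{standard multigraph} is a loopless multigraph in which every two vertices $x,y$ are joined by $\mu(xy)\in\{0,1,2\}$ edges; $\delta(G)$ denotes the minimum, over the vertices of $G$, of the number of edges incident to the vertex. For $r\ge 2$ let $\bar{\mathcal K}_r$ be the family of all standard multigraphs on $r$ vertices obtained from the complete standard multigraph on $r$ vertices (in which $\mu(xy)=2$ for all $x\neq y$) by choosing a (possibly empty) matching and removing one of the two edges between $x$ and $y$ for each pair $xy$ of the matching. A \emph{$\bar{\mathcal K}_r$-tiling} in $G$ is a collection of vertex-disjoint, not necessarily induced, copies in $G$ of elements of $\bar{\mathcal K}_r$; it covers the vertices of its members. We write $0<1/n\ll\eta\ll 1/r$ in the hypothesis of a statement to mean that there are increasing functions $f,g:(0,\infty)\to(0,\infty)$ such that the statement holds for all integers $r\ge 2$, $n\ge 1$ and all real $\eta>0$ with $\eta\le f(1/r)$ and $1/n\le g(\eta)$. \textbf{Theorem.} Let $n,r\in\mathbb N$ with $r\ge 2$ and let $\eta>0$ be such that $0<1/n\ll\eta\ll 1/r$. If $G$ is a standard multigraph on $n$ vertices with $$\delta(G)\ \ge\ 2\left(1-\frac1r+\eta\right)n,$$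 then $G$ contains a $\bar{\mathcal K}_r$-tiling covering all but at most $\eta n$ vertices. \textbf{Corollary.} Let $n,r\in\mathbb N$ with $r\ge 2$ and let $\eta>0$ be such that $0<1/n\ll\eta\ll 1/r$. If $G$ is a standard multigraph on $n$ vertices with $$\delta(G)\ \ge\ 2\left(1-\frac1r-\eta\right)n,$$ then $G$ contains a $\bar{\mathcal K}_r$-tiling covering all but at most $4r^2\eta n$ vertices. -/

import Mathlib

/-- A standard multigraph on the vertex set `V`: a loopless multigraph in which every two vertices
are joined by at most two parallel edges. `G.mult x y` is the number of edges between `x` and `y`;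
the pair `xy` is a light edge if this is `1` and a heavy edge if it is `2`. -/
structure StdMultigraph (V : Type*) where
  mult : V → V → ℕ
  symm : ∀ x y, mult x y = mult y x
  loopless : ∀ x, mult x x = 0
  mult_le_two : ∀ x y, mult x y ≤ 2

namespace StdMultigraph

/-- The number of edges incident to `v`. -/
def degree {V : Type*} [Fintype V] (G : StdMultigraph V) (v : V) : ℕ :=
  ∑ u, G.mult v u

/-- The minimum degree of `G` (used only for a nonempty vertex set). -/
noncomputable def minDegree {V : Type*} [Fintype V] (G : StdMultigraph V) : ℕ :=
  ⨅ v, G.degree v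

open scoped Classical in
/-- The complete standard multigraph on `W`, with two edges between any two distinct vertices. -/
noncomputable def complete (W : Type*) : StdMultigraph W where
  mult x y := if x = y then 0 else 2
  symm x y := by simp only [eq_comm]
  loopless x := by simp
  mult_le_two x y := by split_ifs <;> omega

open scoped Classical in
/-- Remove from `G` one copy of each edge of the simple graph `F`. -/
noncomputable def removeLight {W : Type*} (G : StdMultigraph W) (F : SimpleGraph W) :
    StdMultigraph W where
  mult x y := G.mult x y - if F.Adj x y then 1 else 0
  symm x y := by rw [G.symm x y, F.adj_comm x y]
  loopless x := by simp [G.loopless x]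
  mult_le_two x y := (Nat.sub_le _ _).trans (G.mult_le_two x y)

/-- The family of standard multigraphs on `r` vertices that are obtained from the complete standard
multigraph by removing a (possibly empty) light matching `F`. -/
def KBar (r : ℕ) : Set (StdMultigraph (Fin r)) :=
  {K | ∃ F : SimpleGraph (Fin r),
    (∀ x y z, F.Adj x y → F.Adj x z → y = z) ∧ K = (complete (Fin r)).removeLight F}

/-- A copy of `K` in `G`, that is, a (not necessarily induced) submultigraph of `G` together with
an isomorphism from `K` to it. -/
structure Copy {W V : Type*} (K : StdMultigraph W) (G : StdMultigraph V) where
  toEmbedding : W ↪ V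
  mult_le : ∀ x y, K.mult x y ≤ G.mult (toEmbedding x) (toEmbedding y)

/-- The vertices of `G` that belong to the copy. -/
def Copy.verts {W V : Type*} {K : StdMultigraph W} {G : StdMultigraph V} (c : Copy K G) : Set V :=
  Set.range c.toEmbedding

/-- An `X`-tiling in `G`: a finite collection of vertex-disjoint copies in `G` of elements
of `X`. -/
structure Tiling {W V : Type*} (X : Set (StdMultigraph W)) (G : StdMultigraph V) where
  size : ℕ
  shape : Fin size → StdMultigraph W
  shape_mem : ∀ i, shape i ∈ X
  tile : ∀ i, Copy (shape i) G
  disjoint : ∀ i j, i ≠ j → Disjoint (tile i).verts (tile j).verts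

/-- The set of vertices covered by the tiling. -/
def Tiling.covered {W V : Type*} {X : Set (StdMultigraph W)} {G : StdMultigraph V}
    (T : Tiling X G) : Set V :=
  ⋃ i, (T.tile i).verts

end StdMultigraph

/-- The functions that bound one constant of a hierarchy `α ≪ β` in terms of the next one:
positive and increasing on the positive reals. -/
def IsHierarchyBound (f : ℝ → ℝ) : Prop :=
  (∀ x, 0 < x → 0 < f x) ∧ StrictMonoOn f (Set.Ioi 0)

/-! Missing edges are counted instead of edges: a pair has deficit 2 minus its multiplicity, and a
vertex has deficit 2 to itself. An `r`-set spans a member of `KBar r` exactly when each of its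
vertices has deficit at most 3 to it (a near clique), and the degree condition bounds every deficit
by about `2n/r`.

If every vertex of `W` has deficit at most `2|W|/r` to `W`, then `W` has a perfect fractional tiling
(`exists_perfect_fractional_tiling`). Take an optimal fractional packing. If `x` is not saturated,
no tile in use has deficit at most 1 from `x`, since `x` could then be exchanged into it with profit
(`IsNearClique.insert_or_exchange`). So the used tiles take up so much of the deficit of `x` that
the unsaturated weight is itself dense, and a weighted Turán argument
(`exists_isNearClique_of_weights`) finds a further tile there.

A random tile drawn from the fractional tiling leaves every relative deficit unchanged to first
order. An exponential potential derandomizes this, so tiles can be removed greedily until `ηn`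
vertices are left; the slack `η` in the degree pays for the second-order errors. The corollary
follows by adding about `3rηn` universal vertices and discarding the tiles that use them. -/

/-! ### Linear programming -/

/-- Optimal solutions of a packing linear program exist and satisfy the first order conditions. -/
theorem exists_packing_optimum {ι κ : Type*} [Fintype ι] [Fintype κ] (A : κ → ι → ℝ)
    (hA : ∀ v i, 0 ≤ A v i) (hA' : ∀ i, ∃ v, 1 ≤ A v i) (c : ι → ℝ) :
    ∃ w : ι → ℝ, (∀ i, 0 ≤ w i) ∧ (∀ v, ∑ i, A v i * w i ≤ 1) ∧
      ∀ h : ι → ℝ, (∀ i, h i < 0 → 0 < w i) →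
        (∀ v, 0 < ∑ i, A v i * h i → ∑ i, A v i * w i < 1) → ∑ i, c i * h i ≤ 0 := by
  set C : Set (ι → ℝ) := {w | (∀ i, 0 ≤ w i) ∧ ∀ v, ∑ i, A v i * w i ≤ 1}
  have hbox : C ⊆ Set.Icc 0 1 := by
    rintro w ⟨h0, h1⟩
    refine ⟨h0, fun i => ?_⟩
    obtain ⟨v, hv⟩ := hA' i
    calc w i ≤ A v i * w i := le_mul_of_one_le_left (h0 i) hv
      _ ≤ ∑ j, A v j * w j := Finset.single_le_sum (f := fun j => A v j * w j)
          (fun j _ => mul_nonneg (hA v j) (h0 j)) (Finset.mem_univ i)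
      _ ≤ 1 := h1 v
  have hclosed : IsClosed C := by
    have hCeq : C = (⋂ i, {w | 0 ≤ w i}) ∩ ⋂ v, {w | ∑ i, A v i * w i ≤ 1} := by
      ext w
      simp [C]
    rw [hCeq]
    exact (isClosed_iInter fun i => isClosed_le (by fun_prop) (by fun_prop)).inter
      (isClosed_iInter fun v => isClosed_le (by fun_prop) (by fun_prop))
  have hC : IsCompact C := isCompact_Icc.of_isClosed_subset hclosed hbox
  obtain ⟨w, hw, hmax⟩ := hC.exists_isMaxOn ⟨0, by simp [C]⟩
    (f := fun w => ∑ i, c i * w i) (by fun_prop)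
  refine ⟨w, hw.1, hw.2, fun h h0 h1 => ?_⟩
  -- There are finitely many constraints, and those that `h` pushes towards violation are strict at
  -- `w`, so a small step along `h` stays feasible.
  have e0 : ∀ᶠ t in nhdsWithin (0 : ℝ) (Set.Ioi 0), ∀ i, 0 ≤ w i + t * h i := by
    rw [Filter.eventually_all]
    intro i
    rcases lt_or_ge (h i) 0 with hi | hi
    · have : Filter.Tendsto (fun t => w i + t * h i) (nhdsWithin (0 : ℝ) (Set.Ioi 0))
          (nhds (w i + 0 * h i)) :=
        (Continuous.tendsto (by fun_prop) 0).mono_left nhdsWithin_le_nhds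
      rw [zero_mul, add_zero] at this
      exact (this.eventually_const_lt (h0 i hi)).mono fun t ht => ht.le
    · filter_upwards [self_mem_nhdsWithin] with t ht
      exact add_nonneg (hw.1 i) (mul_nonneg (le_of_lt ht) hi)
  have e1 : ∀ᶠ t in nhdsWithin (0 : ℝ) (Set.Ioi 0),
      ∀ v, ∑ i, A v i * w i + t * ∑ i, A v i * h i ≤ 1 := by
    rw [Filter.eventually_all]
    intro v
    rcases lt_or_ge 0 (∑ i, A v i * h i) with hv | hv
    · have : Filter.Tendsto (fun t => ∑ i, A v i * w i + t * ∑ i, A v i * h i)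
          (nhdsWithin (0 : ℝ) (Set.Ioi 0)) (nhds (∑ i, A v i * w i + 0 * ∑ i, A v i * h i)) :=
        (Continuous.tendsto (by fun_prop) 0).mono_left nhdsWithin_le_nhds
      rw [zero_mul, add_zero] at this
      exact (this.eventually_lt_const (h1 v hv)).mono fun t ht => ht.le
    · filter_upwards [self_mem_nhdsWithin] with t ht
      have := mul_nonpos_of_nonneg_of_nonpos (le_of_lt (Set.mem_Ioi.1 ht)) hv
      linarith [hw.2 v]
  obtain ⟨t, ht0, ht1, ht⟩ := (e0.and (e1.and self_mem_nhdsWithin)).exists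
  have hsum : ∀ a : ι → ℝ, ∑ i, a i * (w i + t * h i) = ∑ i, a i * w i + t * ∑ i, a i * h i := by
    intro a
    rw [Finset.mul_sum, ← Finset.sum_add_distrib]
    exact Finset.sum_congr rfl fun i _ => by ring
  have := hmax (show (fun i => w i + t * h i) ∈ C from ⟨ht0, fun v => by
    show ∑ i, A v i * (w i + t * h i) ≤ 1
    rw [hsum]; exact ht1 v⟩)
  simp only [Set.mem_ofPred_eq, hsum] at this
  exact nonpos_of_mul_nonpos_right (by linarith) ht

namespace StdMultigraph

open Finset

/-! ### Near cliques and a weighted Turán theorem -/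

section Deficits

variable {V : Type*}

/-- The number of edges missing between `x` and `y`, compared with a heavy edge. -/
def deficit (G : StdMultigraph V) (x y : V) : ℕ := 2 - G.mult x y

/-- The number of edges missing between `x` and the vertices of `S`. -/
def deficitTo (G : StdMultigraph V) (x : V) (S : Finset V) : ℕ := ∑ y ∈ S, G.deficit x y

/-- The sum of the deficits over all ordered pairs of vertices of `S`. -/
def totalDeficit (G : StdMultigraph V) (S : Finset V) : ℕ := ∑ x ∈ S, G.deficitTo x S

/-- Any two vertices of `S` are adjacent and the light edges inside `S` form a matching. As
`deficit x x = 2`, this says that each vertex misses at most one edge to the other ones. -/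
def IsNearClique (G : StdMultigraph V) (S : Finset V) : Prop := ∀ x ∈ S, G.deficitTo x S ≤ 3

theorem deficit_self (G : StdMultigraph V) (x : V) : G.deficit x x = 2 := by
  simp [deficit, G.loopless]

theorem deficit_comm (G : StdMultigraph V) (x y : V) : G.deficit x y = G.deficit y x := by
  simp [deficit, G.symm x y]

theorem deficit_le_two (G : StdMultigraph V) (x y : V) : G.deficit x y ≤ 2 := Nat.sub_le _ _

theorem deficitTo_le (G : StdMultigraph V) (x : V) (S : Finset V) :
    G.deficitTo x S ≤ 2 * S.card := by
  rw [mul_comm, ← smul_eq_mul]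
  exact Finset.sum_le_card_nsmul _ _ _ fun y _ => G.deficit_le_two x y

theorem deficit_le_deficitTo (G : StdMultigraph V) (x : V) {y : V} {S : Finset V} (hy : y ∈ S) :
    G.deficit x y ≤ G.deficitTo x S :=
  Finset.single_le_sum (f := G.deficit x) (fun _ _ => Nat.zero_le _) hy

theorem two_le_deficitTo (G : StdMultigraph V) {x : V} {S : Finset V} (hx : x ∈ S) :
    2 ≤ G.deficitTo x S :=
  (G.deficit_self x).symm.le.trans (G.deficit_le_deficitTo x hx)

theorem deficitTo_mono (G : StdMultigraph V) (x : V) {S T : Finset V} (h : S ⊆ T) :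
    G.deficitTo x S ≤ G.deficitTo x T :=
  Finset.sum_le_sum_of_subset h

theorem IsNearClique.mono {G : StdMultigraph V} {S T : Finset V} (hT : G.IsNearClique T)
    (h : S ⊆ T) : G.IsNearClique S :=
  fun x hx => (G.deficitTo_mono x h).trans (hT x (h hx))

theorem IsNearClique.totalDeficit_le {G : StdMultigraph V} {S : Finset V}
    (hS : G.IsNearClique S) : G.totalDeficit S ≤ 3 * S.card := by
  rw [mul_comm, ← smul_eq_mul]
  exact Finset.sum_le_card_nsmul _ _ _ hS

theorem two_mul_card_le_totalDeficit (G : StdMultigraph V) (S : Finset V) :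
    2 * S.card ≤ G.totalDeficit S := by
  rw [mul_comm, ← smul_eq_mul]
  exact Finset.card_nsmul_le_sum _ _ _ fun x hx => G.two_le_deficitTo hx

variable [DecidableEq V]

theorem deficitTo_insert (G : StdMultigraph V) (y : V) {x : V} {S : Finset V} (hx : x ∉ S) :
    G.deficitTo y (insert x S) = G.deficit y x + G.deficitTo y S :=
  Finset.sum_insert hx

theorem deficitTo_erase_add (G : StdMultigraph V) (y : V) {v : V} {S : Finset V} (hv : v ∈ S) :
    G.deficitTo y (S.erase v) + G.deficit y v = G.deficitTo y S :=
  Finset.sum_erase_add _ _ hv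

theorem totalDeficit_insert (G : StdMultigraph V) {x : V} {S : Finset V} (hx : x ∉ S) :
    G.totalDeficit (insert x S) = 2 + 2 * G.deficitTo x S + G.totalDeficit S := by
  have h : ∑ y ∈ S, G.deficitTo y (insert x S) = G.deficitTo x S + G.totalDeficit S := by
    rw [totalDeficit, deficitTo, ← Finset.sum_add_distrib]
    exact Finset.sum_congr rfl fun y _ => by rw [G.deficitTo_insert y hx, G.deficit_comm]
  rw [totalDeficit, Finset.sum_insert hx, h, G.deficitTo_insert x hx, deficit_self]
  omega

/-- A vertex missing at most one edge to a near clique either extends it, or can be exchanged for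
one of its vertices so that the number of light edges drops. -/
theorem IsNearClique.insert_or_exchange {G : StdMultigraph V} {S : Finset V}
    (hS : G.IsNearClique S) {x : V} (hx : G.deficitTo x S ≤ 1) :
    x ∉ S ∧ (G.IsNearClique (insert x S) ∨ ∃ v ∈ S, G.IsNearClique (insert x (S.erase v)) ∧
      G.totalDeficit (insert x (S.erase v)) < G.totalDeficit S) := by
  have hxS : x ∉ S := fun h => by have := G.two_le_deficitTo h; omega
  refine ⟨hxS, ?_⟩
  by_cases hv : ∃ v ∈ S, G.deficit x v ≠ 0 ∧ G.deficitTo v S = 3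
  -- The only edge that `x` misses goes to `v`, and `v` misses another one inside `S`. Exchanging
  -- `v` for `x` avoids both, so the total deficit drops by 2.
  · obtain ⟨v, hvS, hxv, hv3⟩ := hv
    have h1 := G.deficitTo_erase_add x hvS
    have h2 := G.deficitTo_erase_add v hvS
    have hx' : x ∉ S.erase v := fun h => hxS (Finset.mem_of_mem_erase h)
    have h3 := G.totalDeficit_insert hx'
    have h4 := G.totalDeficit_insert (Finset.notMem_erase v S)
    rw [Finset.insert_erase hvS] at h4
    rw [G.deficit_self] at h2
    have h0 : G.deficitTo x (S.erase v) = 0 := by omega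
    refine Or.inr ⟨v, hvS, fun y hy => ?_, by omega⟩
    rw [G.deficitTo_insert y hx']
    rcases Finset.mem_insert.1 hy with rfl | hy
    · rw [G.deficit_self]; omega
    · have h5 := G.deficit_le_deficitTo x hy
      have h6 := hS y (Finset.mem_of_mem_erase hy)
      have h7 := G.deficitTo_erase_add y hvS
      rw [G.deficit_comm y x]
      omega
  · push Not at hv
    refine Or.inl fun y hy => ?_
    rw [G.deficitTo_insert y hxS]
    rcases Finset.mem_insert.1 hy with rfl | hy
    · rw [G.deficit_self]; omega
    · have h5 := G.deficit_le_deficitTo x hy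
      have h6 := hS y hy
      have h7 := hv y hy
      rw [G.deficit_comm y x]
      by_cases h : G.deficit x y = 0
      · omega
      · have := h7 h; omega

/-- A weighted Turán theorem for near cliques. -/
theorem exists_isNearClique_of_weights [Fintype V] (G : StdMultigraph V) {r : ℕ} {z : V → ℝ}
    (hz : ∀ v, 0 ≤ z v) (hpos : 0 < ∑ v, z v)
    (hdef : ∀ x, 0 < z x → r * ∑ y, z y * G.deficit x y ≤ 2 * ∑ y, z y) :
    ∀ p ≤ r, ∃ S : Finset V, S.card = p ∧ G.IsNearClique S ∧ ∀ v ∈ S, 0 < z v := by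
  classical
  intro p
  induction p with
  | zero => exact fun _ => ⟨∅, by simp [IsNearClique]⟩
  | succ p ih =>
    intro hp
    obtain ⟨S₀, h₀⟩ := ih (by omega)
    obtain ⟨S, hS, hmin⟩ := Finset.exists_min_image
      (univ.filter fun S : Finset V => S.card = p ∧ G.IsNearClique S ∧ ∀ v ∈ S, 0 < z v)
      G.totalDeficit ⟨S₀, by simpa using h₀⟩
    simp only [mem_filter, mem_univ, true_and] at hS hmin
    obtain ⟨hcard, hclique, hSz⟩ := hS
    -- Averaging: a set of `p < r` vertices receives less than `2 * ∑ z` of weighted deficit, so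
    -- some vertex of positive weight has deficit below 2 to it.
    obtain ⟨x, hxz, hx⟩ : ∃ x, 0 < z x ∧ G.deficitTo x S ≤ 1 := by
      by_contra! hcon
      have h1 : 2 * ∑ y, z y ≤ ∑ y, z y * G.deficitTo y S := by
        rw [Finset.mul_sum]
        refine Finset.sum_le_sum fun y _ => ?_
        rcases (hz y).eq_or_lt with h | h
        · simp [← h]
        · have : (2 : ℝ) ≤ G.deficitTo y S := by exact_mod_cast hcon y h
          nlinarith
      have h2 : ∑ y, z y * (G.deficitTo y S : ℝ) = ∑ x ∈ S, ∑ y, z y * G.deficit x y := by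
        rw [Finset.sum_comm]
        refine Finset.sum_congr rfl fun y _ => ?_
        rw [deficitTo, Nat.cast_sum, Finset.mul_sum]
        exact Finset.sum_congr rfl fun x _ => by rw [G.deficit_comm]
      have h3 : r * ∑ y, z y * (G.deficitTo y S : ℝ) ≤ p * (2 * ∑ y, z y) := by
        rw [h2, Finset.mul_sum, ← hcard, ← nsmul_eq_mul]
        exact Finset.sum_le_card_nsmul _ _ _ fun x hx => hdef x (hSz x hx)
      have h4 : (p : ℝ) + 1 ≤ r := by exact_mod_cast hp
      have h5 : (r : ℝ) * (2 * ∑ y, z y) ≤ r * ∑ y, z y * (G.deficitTo y S : ℝ) :=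
        mul_le_mul_of_nonneg_left h1 (Nat.cast_nonneg r)
      nlinarith
    obtain ⟨hxS, h | ⟨v, hv, hnear, hlt⟩⟩ := hclique.insert_or_exchange hx
    · refine ⟨insert x S, by rw [card_insert_of_notMem hxS, hcard], h, fun v hv => ?_⟩
      rcases Finset.mem_insert.1 hv with rfl | hv
      exacts [hxz, hSz v hv]
    · refine absurd (hmin _ ⟨?_, hnear, fun u hu => ?_⟩) (not_le.2 hlt)
      · rw [card_insert_of_notMem fun h => hxS (mem_of_mem_erase h), card_erase_add_one hv, hcard]
      · rcases Finset.mem_insert.1 hu with rfl | hu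
        exacts [hxz, hSz u (mem_of_mem_erase hu)]

end Deficits

/-! ### Perfect fractional tilings -/

section FractionalTiling

variable {V : Type*}

open scoped Classical in
/-- The near cliques with `r` vertices inside `W`. -/
noncomputable def nearCliques (G : StdMultigraph V) (r : ℕ) (W : Finset V) : Finset (Finset V) :=
  (W.powersetCard r).filter G.IsNearClique

theorem mem_nearCliques {G : StdMultigraph V} {r : ℕ} {W K : Finset V} :
    K ∈ G.nearCliques r W ↔ (K ⊆ W ∧ K.card = r) ∧ G.IsNearClique K := by
  simp [nearCliques, mem_powersetCard]

theorem sum_mul_deficit (G : StdMultigraph V) [Fintype V] [DecidableEq V] (x : V) (S : Finset V) :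
    ∑ y, (if y ∈ S then (1 : ℝ) else 0) * G.deficit x y = G.deficitTo x S := by
  simp [deficitTo, ite_mul]

/-- If every vertex of `W` misses at most `2|W|/r` edges inside `W`, then `W` has a perfect
fractional tiling with near cliques on `r` vertices. -/
theorem exists_perfect_fractional_tiling [Fintype V] [DecidableEq V] (G : StdMultigraph V) {r : ℕ}
    (hr : 1 ≤ r) (W : Finset V) (hW : ∀ v ∈ W, r * G.deficitTo v W ≤ 2 * W.card) :
    ∃ w : {K // K ∈ G.nearCliques r W} → ℝ, (∀ K, 0 ≤ w K) ∧
      ∀ v ∈ W, ∑ K, (if v ∈ K.1 then (1 : ℝ) else 0) * w K = 1 := by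
  set A : V → {K // K ∈ G.nearCliques r W} → ℝ := fun v K => if v ∈ K.1 then 1 else 0 with hAdef
  -- The term `4r²` makes total weight dominate; the total deficit only makes tiles with fewer light
  -- edges preferable. All values lie between `4r² - 3r` and `4r² - 2r`, so `r` tiles are always
  -- worth more than `r - 1`.
  set c : {K // K ∈ G.nearCliques r W} → ℝ := fun K => 4 * (r : ℝ) ^ 2 - G.totalDeficit K.1
  have hr' : (1 : ℝ) ≤ r := by exact_mod_cast hr
  have hsub : ∀ K : {K // K ∈ G.nearCliques r W}, K.1 ⊆ W := fun K => (mem_nearCliques.1 K.2).1.1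
  have hcard : ∀ K : {K // K ∈ G.nearCliques r W}, K.1.card = r :=
    fun K => (mem_nearCliques.1 K.2).1.2
  have hnear : ∀ K : {K // K ∈ G.nearCliques r W}, G.IsNearClique K.1 :=
    fun K => (mem_nearCliques.1 K.2).2
  have hc_lower : ∀ K, 4 * (r : ℝ) ^ 2 - 3 * r ≤ c K := fun K => by
    have h := (hnear K).totalDeficit_le
    rw [hcard] at h
    have : (G.totalDeficit K.1 : ℝ) ≤ 3 * r := by exact_mod_cast h
    simp only [c]; linarith
  have hc_upper : ∀ K, c K ≤ 4 * (r : ℝ) ^ 2 - 2 * r := fun K => by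
    have h := G.two_mul_card_le_totalDeficit K.1
    rw [hcard] at h
    have : (2 * r : ℝ) ≤ G.totalDeficit K.1 := by exact_mod_cast h
    simp only [c]; linarith
  obtain ⟨w, hw0, hw1, hopt⟩ := exists_packing_optimum A
    (fun v K => by simp only [hAdef]; split_ifs <;> norm_num)
    (fun K => by
      obtain ⟨v, hv⟩ := Finset.card_pos.1 ((hcard K).symm ▸ hr)
      exact ⟨v, by simp [hAdef, hv]⟩) c
  refine ⟨w, hw0, ?_⟩
  set cov : V → ℝ := fun v => ∑ K, A v K * w K with hcov
  by_contra! hcon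
  obtain ⟨x₀, hx₀W, hx₀⟩ := hcon
  replace hx₀ : cov x₀ < 1 := lt_of_le_of_ne (hw1 x₀) hx₀
  set e : {K // K ∈ G.nearCliques r W} → {K // K ∈ G.nearCliques r W} → ℝ :=
    fun K i => if i = K then 1 else 0 with he
  have hsingle : ∀ (a : {K // K ∈ G.nearCliques r W} → ℝ) (K), ∑ i, a i * e K i = a K := by
    intro a K
    simp [he]
  have hexch : ∀ (K : Finset V) (x v : V), x ∈ W → x ∉ K → v ∈ K → K ∈ G.nearCliques r W →
      G.IsNearClique (insert x (K.erase v)) → insert x (K.erase v) ∈ G.nearCliques r W := by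
    intro K x v hxW hxK hv hK hnear
    have hK' := (mem_nearCliques.1 hK).1
    refine mem_nearCliques.2 ⟨⟨insert_subset hxW ((erase_subset _ _).trans hK'.1), ?_⟩, hnear⟩
    rw [card_insert_of_notMem fun h => hxK (mem_of_mem_erase h), card_erase_add_one hv, hK'.2]
  have huncov : ∀ x ∈ W, cov x < 1 → ∀ K, 0 < w K → 2 ≤ G.deficitTo x K.1 := by
    intro x hxW hx K hK
    by_contra! hlt
    obtain ⟨hxK, h | ⟨v, hv, hn, hd⟩⟩ := (hnear K).insert_or_exchange (x := x) (by omega)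
    -- Here `K` with `x` added is a near clique on `r + 1` vertices. Trading `r - 1` units of `K`
    -- for one unit of each of the `r` sets that swap some `v` for `x` keeps the cover of every
    -- vertex of `K` and raises only that of `x`.
    · have hmem : ∀ v : {v // v ∈ K.1}, insert x (K.1.erase v) ∈ G.nearCliques r W := fun v =>
        hexch K.1 x v hxW hxK v.2 K.2 (h.mono (insert_subset_insert _ (erase_subset _ _)))
      set N : {v // v ∈ K.1} → {K // K ∈ G.nearCliques r W} := fun v => ⟨_, hmem v⟩ with hN
      have hsum : ∀ a : {K // K ∈ G.nearCliques r W} → ℝ,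
          ∑ i, a i * ((∑ v, e (N v) i) - (r - 1) * e K i) =
            ∑ v, a (N v) - (r - 1) * a K := by
        intro a
        simp only [mul_sub, Finset.sum_sub_distrib, Finset.mul_sum]
        rw [Finset.sum_comm]
        simp only [hsingle]
        congr 1
        rw [← hsingle a K, Finset.mul_sum]
        exact Finset.sum_congr rfl fun i _ => by ring
      have hle := hopt (fun i => (∑ v, e (N v) i) - (r - 1) * e K i)
        (fun i hi => ?_) (fun u hu => ?_)
      · rw [hsum] at hle
        have h1 : (r : ℝ) * (4 * (r : ℝ) ^ 2 - 3 * r) ≤ ∑ v, c (N v) := by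
          have := Finset.card_nsmul_le_sum univ (fun v => c (N v)) _ fun v _ => hc_lower (N v)
          rwa [card_univ, Fintype.card_coe, hcard, nsmul_eq_mul] at this
        nlinarith [hc_upper K, hc_lower K]
      · by_cases hiK : i = K
        · rwa [hiK]
        · rw [show e K i = 0 from if_neg hiK, mul_zero, sub_zero] at hi
          exact absurd hi (not_lt.2 (Finset.sum_nonneg fun v _ => by
            simp only [he]; split_ifs <;> norm_num))
      · rw [hsum] at hu
        by_cases hux : u = x
        · rwa [hux]
        · exfalso
          by_cases huK : u ∈ K.1
          · have h1 : ∀ v, A u (N v) = 1 - if v = ⟨u, huK⟩ then 1 else 0 := by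
              intro v
              by_cases huv : v = ⟨u, huK⟩
              · subst huv; simp [hAdef, hN, hux]
              · have : u ≠ v := fun h => huv (Subtype.ext h.symm)
                simp [hAdef, hN, hux, huK, this, huv]
            simp only [h1, Finset.sum_sub_distrib] at hu
            simp [hAdef, huK, hcard] at hu
          · simp [hAdef, hN, hux, huK] at hu
    · have hmem := hexch K.1 x v hxW hxK hv K.2 hn
      have hsum : ∀ a : {K // K ∈ G.nearCliques r W} → ℝ,
          ∑ i, a i * (e ⟨_, hmem⟩ i -
            e K i) = a ⟨_, hmem⟩ - a K := by
        intro a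
        simp only [mul_sub, Finset.sum_sub_distrib, hsingle]
      have hle := hopt (fun i => e ⟨_, hmem⟩ i -
            e K i) (fun i hi => ?_) (fun u hu => ?_)
      · rw [hsum] at hle
        have : (G.totalDeficit (insert x (K.1.erase v)) : ℝ) < G.totalDeficit K.1 := by
          exact_mod_cast hd
        simp only [c] at hle
        linarith
      · by_cases hiK : i = K
        · rwa [hiK]
        · rw [show e K i = 0 from if_neg hiK, sub_zero] at hi
          simp only [he] at hi
          split_ifs at hi <;> norm_num at hi
      · rw [hsum] at hu
        by_cases hux : u = x
        · rwa [hux]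
        · exfalso
          simp only [hAdef, mem_insert, hux, false_or, mem_erase] at hu
          split_ifs at hu <;> first | linarith | tauto
  -- The uncovered part of each vertex of `W` serves as its Turán weight.
  set z : V → ℝ := fun v => if v ∈ W then 1 - cov v else 0 with hz
  have hz0 : ∀ v, 0 ≤ z v := fun v => by
    simp only [hz]
    split_ifs
    exacts [sub_nonneg.2 (hw1 v), le_rfl]
  have hzW : ∀ v, 0 < z v → v ∈ W ∧ cov v < 1 := fun v hv => by
    by_cases hvW : v ∈ W
    · simp only [hz, if_pos hvW] at hv
      exact ⟨hvW, by linarith⟩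
    · simp [hz, hvW] at hv
  have hzpos : 0 < ∑ v, z v :=
    Finset.sum_pos' (fun v _ => hz0 v) ⟨x₀, mem_univ _, by simp [hz, hx₀W, hx₀]⟩
  have hcovW : ∀ v, v ∉ W → cov v = 0 := fun v hv =>
    Finset.sum_eq_zero fun K _ => by
      have : v ∉ K.1 := fun h => hv (hsub K h)
      simp [hAdef, this]
  have hz' : ∀ v, z v = (if v ∈ W then 1 else 0) - cov v := fun v => by
    by_cases hv : v ∈ W <;> simp [hz, hv, hcovW]
  have hsumz : ∑ v, z v = W.card - r * ∑ K, w K := by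
    simp only [hz', Finset.sum_sub_distrib]
    congr 1
    · simp
    · rw [hcov, Finset.sum_comm, Finset.mul_sum]
      refine Finset.sum_congr rfl fun K _ => ?_
      rw [← Finset.sum_mul]
      simp [hAdef, hcard]
  have hsumzd : ∀ x, ∑ v, z v * G.deficit x v =
      G.deficitTo x W - ∑ K, w K * G.deficitTo x K.1 := by
    intro x
    simp only [hz', sub_mul, Finset.sum_sub_distrib, sum_mul_deficit]
    congr 1
    simp only [hcov, Finset.sum_mul]
    rw [Finset.sum_comm]
    refine Finset.sum_congr rfl fun K _ => ?_
    rw [← sum_mul_deficit, Finset.mul_sum]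
    exact Finset.sum_congr rfl fun v _ => by simp only [hAdef]; ring
  obtain ⟨S, hS, hSn, hSz⟩ := G.exists_isNearClique_of_weights (r := r) hz0 hzpos (fun x hx => by
    obtain ⟨hxW, hxc⟩ := hzW x hx
    -- Each unit of tile weight absorbs deficit at least 2 from `x`, so the deficit left towards `z`
    -- is at most `2|W|/r - 2 ∑ w = (2/r) ∑ z`.
    have h1 : 2 * ∑ K, w K ≤ ∑ K, w K * G.deficitTo x K.1 := by
      rw [Finset.mul_sum]
      refine Finset.sum_le_sum fun K _ => ?_
      rcases (hw0 K).eq_or_lt with h | h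
      · simp [← h]
      · have : (2 : ℝ) ≤ G.deficitTo x K.1 := by exact_mod_cast huncov x hxW hxc K h
        nlinarith
    have h2 : (r : ℝ) * G.deficitTo x W ≤ 2 * W.card := by exact_mod_cast hW x hxW
    rw [hsumzd, hsumz]
    nlinarith) r le_rfl
  have hSmem : S ∈ G.nearCliques r W :=
    mem_nearCliques.2 ⟨⟨fun v hv => (hzW v (hSz v hv)).1, hS⟩, hSn⟩
  -- All vertices of `S` are unsaturated, so its weight could be raised, although its objective
  -- coefficient is positive.
  have hle := hopt (e ⟨S, hSmem⟩) (fun i hi => ?_) (fun u hu => ?_)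
  · rw [hsingle] at hle
    have := hc_lower ⟨S, hSmem⟩
    nlinarith
  · simp only [he] at hi
    split_ifs at hi <;> norm_num at hi
  · rw [hsingle] at hu
    by_cases huS : u ∈ S
    · exact (hzW u (hSz u huS)).2
    · simp [hAdef, huS] at hu

end FractionalTiling

/-! ### From fractional to integral tilings -/

section Greedy

variable {V : Type*}

/-- The exponential potential of the relative deficits of all vertices into `W`. -/
noncomputable def potential [Fintype V] (G : StdMultigraph V) (θ : ℝ) (W : Finset V) : ℝ :=
  ∑ v, Real.exp (θ * (G.deficitTo v W / W.card))

theorem exp_le_potential [Fintype V] (G : StdMultigraph V) (θ : ℝ) (W : Finset V) (v : V) :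
    Real.exp (θ * (G.deficitTo v W / W.card)) ≤ G.potential θ W :=
  Finset.single_le_sum (f := fun v => Real.exp (θ * (G.deficitTo v W / W.card)))
    (fun _ _ => (Real.exp_pos _).le) (mem_univ v)

theorem deficitTo_sdiff_add [DecidableEq V] (G : StdMultigraph V) (v : V) {K W : Finset V}
    (h : K ⊆ W) : G.deficitTo v (W \ K) + G.deficitTo v K = G.deficitTo v W :=
  Finset.sum_sdiff h

/-- Some tile can be removed from `W` so that the potential hardly grows. -/
theorem exists_nearClique_potential_le [Fintype V] [DecidableEq V] (G : StdMultigraph V) {r : ℕ}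
    (hr : 1 ≤ r) {θ b : ℝ} (hθ : 0 ≤ θ) (hb : b ≤ 1) (W : Finset V) (hrW : r < W.card)
    (hW : ∀ v ∈ W, r * G.deficitTo v W ≤ 2 * W.card)
    (hθb : θ * (2 * r) ≤ b * (W.card - r)) :
    ∃ K ∈ G.nearCliques r W, G.potential θ (W \ K) ≤ (1 + b ^ 2) * G.potential θ W := by
  obtain ⟨w, hw0, hw1⟩ := G.exists_perfect_fractional_tiling hr W hW
  have hsub : ∀ K : {K // K ∈ G.nearCliques r W}, K.1 ⊆ W := fun K => (mem_nearCliques.1 K.2).1.1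
  have hcard : ∀ K : {K // K ∈ G.nearCliques r W}, K.1.card = r :=
    fun K => (mem_nearCliques.1 K.2).1.2
  have hm : (0 : ℝ) < W.card - r := sub_pos.2 (by exact_mod_cast hrW)
  have hm0 : (0 : ℝ) < W.card := by exact_mod_cast (by omega : 0 < W.card)
  have hr0 : (0 : ℝ) < r := by exact_mod_cast hr
  have hcov : ∀ K : {K // K ∈ G.nearCliques r W}, ∀ v, v ∉ W → v ∉ K.1 := fun K v hv h =>
    hv (hsub K h)
  have hsum_deficit : ∀ v, ∑ K, w K * G.deficitTo v K.1 = G.deficitTo v W := by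
    intro v
    simp only [← sum_mul_deficit, Finset.mul_sum]
    rw [Finset.sum_comm]
    refine Finset.sum_congr rfl fun u _ => ?_
    by_cases hu : u ∈ W
    · rw [if_pos hu]
      refine Eq.trans ?_ (congrArg (· * (G.deficit v u : ℝ)) (hw1 u hu))
      simp only [Finset.sum_mul]
      exact Finset.sum_congr rfl fun K _ => by ring
    · simp [hu, hcov _ u hu]
  have hsum : r * ∑ K, w K = W.card := by
    have h1 : ∑ v ∈ W, ∑ K, (if v ∈ K.1 then (1 : ℝ) else 0) * w K = W.card := by
      rw [Finset.sum_congr rfl hw1]; simp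
    rw [← h1, Finset.sum_comm, Finset.mul_sum]
    refine Finset.sum_congr rfl fun K _ => ?_
    rw [← Finset.sum_mul, ← Finset.sum_filter, Finset.filter_mem_eq_inter,
      Finset.inter_eq_right.2 (hsub K)]
    simp [hcard]
  have hvertex : ∀ v, ∑ K, w K * Real.exp (θ * (G.deficitTo v (W \ K.1) / (W \ K.1).card)) ≤
      (∑ K, w K) * ((1 + b ^ 2) * Real.exp (θ * (G.deficitTo v W / W.card))) := by
    intro v
    set a : ℝ := (G.deficitTo v W : ℝ) with ha
    set q : ℝ := θ * (a / W.card) with hq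
    -- The change of the exponent when `K` is removed. Its `w`-average vanishes because the
    -- fractional tiling covers `W` uniformly.
    set Δ : {K // K ∈ G.nearCliques r W} → ℝ := fun K =>
      θ / (W.card - r) * (r * a / W.card - G.deficitTo v K.1) with hΔ
    have hΔsum : ∑ K, w K * Δ K = 0 := by
      have h : ∀ K, w K * Δ K = θ / (W.card - r) *
          (r * a / W.card * w K - w K * G.deficitTo v K.1) := fun K => by simp only [hΔ]; ring
      rw [Finset.sum_congr rfl fun K _ => h K, ← Finset.mul_sum, Finset.sum_sub_distrib,
        ← Finset.mul_sum, hsum_deficit]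
      have : r * a / W.card * ∑ K, w K = a := by
        rw [div_mul_eq_mul_div, mul_right_comm, hsum, mul_div_cancel_left₀ _ hm0.ne']
      rw [this, sub_self, mul_zero]
    have hexp : ∀ K, Real.exp (θ * (G.deficitTo v (W \ K.1) / (W \ K.1).card)) ≤
        Real.exp q * (1 + b ^ 2 + Δ K) := by
      intro K
      have h1 : ((W \ K.1).card : ℝ) = W.card - r := by
        have := Finset.card_sdiff_add_card_eq_card (hsub K)
        rw [hcard] at this
        rw [← this]; push_cast; ring
      have h2 : (G.deficitTo v (W \ K.1) : ℝ) = a - G.deficitTo v K.1 := by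
        rw [ha, ← G.deficitTo_sdiff_add v (hsub K)]; push_cast; ring
      have h3 : θ * (G.deficitTo v (W \ K.1) / (W \ K.1).card) = q + Δ K := by
        rw [h1, h2]
        simp only [hq, hΔ]
        field_simp
        ring
      have h4 : |Δ K| ≤ b := by
        have e1 : (G.deficitTo v K.1 : ℝ) ≤ 2 * r := by
          have := G.deficitTo_le v K.1
          rw [hcard] at this
          exact_mod_cast this
        have e2 : r * a / W.card ≤ 2 * r := by
          have : a ≤ 2 * W.card := by
            rw [ha]; exact_mod_cast G.deficitTo_le v W
          rw [div_le_iff₀ hm0]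
          nlinarith
        have e3 : 0 ≤ r * a / W.card := by positivity
        have e4 : |r * a / W.card - G.deficitTo v K.1| ≤ 2 * r := by
          rw [abs_le]
          constructor <;> linarith [(Nat.cast_nonneg (G.deficitTo v K.1) : (0 : ℝ) ≤ _)]
        simp only [hΔ]
        rw [abs_mul, abs_of_nonneg (div_nonneg hθ hm.le)]
        calc θ / (W.card - r) * |r * a / W.card - G.deficitTo v K.1|
            ≤ θ / (W.card - r) * (2 * r) :=
              mul_le_mul_of_nonneg_left e4 (div_nonneg hθ hm.le)
          _ = θ * (2 * r) / (W.card - r) := by ring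
          _ ≤ b := by rwa [div_le_iff₀ hm]
      rw [h3, Real.exp_add]
      refine mul_le_mul_of_nonneg_left ?_ (Real.exp_pos q).le
      -- This is `exp Δ ≤ 1 + Δ + Δ²` for `|Δ| ≤ 1`; the linear term averages out and leaves the
      -- factor `1 + b²`.
      have h5 := (abs_le.1 (Real.abs_exp_sub_one_sub_id_le (h4.trans hb))).2
      have h6 : Δ K ^ 2 ≤ b ^ 2 := sq_le_sq' (neg_le_of_abs_le h4) (le_of_abs_le h4)
      linarith
    calc ∑ K, w K * Real.exp (θ * (G.deficitTo v (W \ K.1) / (W \ K.1).card))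
        ≤ ∑ K, w K * (Real.exp q * (1 + b ^ 2 + Δ K)) :=
          Finset.sum_le_sum fun K _ => mul_le_mul_of_nonneg_left (hexp K) (hw0 K)
      _ = ∑ K, ((1 + b ^ 2) * Real.exp q * w K + Real.exp q * (w K * Δ K)) :=
          Finset.sum_congr rfl fun K _ => by ring
      _ = (∑ K, w K) * ((1 + b ^ 2) * Real.exp q) := by
          rw [Finset.sum_add_distrib, ← Finset.mul_sum, ← Finset.mul_sum, hΔsum]; ring
  by_contra! hcon
  have hle : ∑ K, w K * G.potential θ (W \ K.1) ≤
      (∑ K, w K) * ((1 + b ^ 2) * G.potential θ W) := by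
    simp only [potential, Finset.mul_sum]
    rw [Finset.sum_comm]
    refine Finset.sum_le_sum fun v _ => (hvertex v).trans_eq ?_
    rfl
  have hwpos : ∃ K, 0 < w K := by
    by_contra! h
    have : ∑ K, w K ≤ 0 := Finset.sum_nonpos fun K _ => h K
    nlinarith
  obtain ⟨K₀, hK₀⟩ := hwpos
  refine absurd hle (not_le.2 ?_)
  rw [Finset.sum_mul]
  exact Finset.sum_lt_sum (fun K _ => mul_le_mul_of_nonneg_left (hcon K K.2).le (hw0 K))
    ⟨K₀, mem_univ _, mul_lt_mul_of_pos_left (hcon K₀ K₀.2) hK₀⟩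

/-- As long as the potential is small, tiles can be removed greedily. -/
theorem exists_disjoint_nearCliques_of_potential [Fintype V] [DecidableEq V] (G : StdMultigraph V)
    {r : ℕ} (hr : 1 ≤ r) {θ b s : ℝ} (hθ : 0 < θ) (hb : b ≤ 1) (hs : (r : ℝ) ≤ s)
    (hθb : ∀ m : ℝ, s < m → θ * (2 * r) ≤ b * (m - r)) (W : Finset V)
    (hW : G.potential θ W * (1 + b ^ 2) ^ W.card ≤ Real.exp (θ * (2 / r))) :
    ∃ 𝒯 : Finset (Finset V), (∀ K ∈ 𝒯, K ∈ G.nearCliques r W) ∧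
      (𝒯 : Set (Finset V)).PairwiseDisjoint id ∧ (W.card : ℝ) - r * 𝒯.card ≤ s := by
  induction W using Finset.strongInduction with
  | H W ih =>
    by_cases hWs : (W.card : ℝ) ≤ s
    · exact ⟨∅, by simp, by simp, by simpa using hWs⟩
    push Not at hWs
    have hrW : r < W.card := by exact_mod_cast hs.trans_lt hWs
    have hm0 : (0 : ℝ) < W.card := by exact_mod_cast (by omega : 0 < W.card)
    have hr0 : (0 : ℝ) < r := by exact_mod_cast hr
    have hb1 : 1 ≤ 1 + b ^ 2 := by nlinarith [sq_nonneg b]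
    have hpot : 0 ≤ G.potential θ W := Finset.sum_nonneg fun _ _ => (Real.exp_pos _).le
    obtain ⟨K, hK, hKpot⟩ := G.exists_nearClique_potential_le hr hθ.le hb W hrW (fun v hv => by
      -- A single summand of the potential already stays below `exp (2θ/r)`, which is the deficit
      -- condition needed for the next tile.
      have h1 : Real.exp (θ * (G.deficitTo v W / W.card)) ≤ Real.exp (θ * (2 / r)) :=
        (G.exp_le_potential θ W v).trans
          ((le_mul_of_one_le_right hpot (one_le_pow₀ hb1)).trans hW)
      have h2 := le_of_mul_le_mul_left (Real.exp_le_exp.1 h1) hθ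
      rw [div_le_div_iff₀ hm0 hr0] at h2
      rw [mul_comm]
      exact_mod_cast h2) (hθb _ hWs)
    obtain ⟨⟨hKW, hKr⟩, -⟩ := mem_nearCliques.1 hK
    have hKne : K.Nonempty := Finset.card_pos.1 (hKr.symm ▸ hr)
    have hcard := Finset.card_sdiff_add_card_eq_card hKW
    -- The budget reserves a factor `1 + b²` per vertex of `W`; one tile spends a single factor and
    -- frees `r ≥ 1` of them.
    have hpot' : G.potential θ (W \ K) * (1 + b ^ 2) ^ (W \ K).card ≤ Real.exp (θ * (2 / r)) := by
      refine le_trans ?_ hW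
      calc G.potential θ (W \ K) * (1 + b ^ 2) ^ (W \ K).card
          ≤ (1 + b ^ 2) * G.potential θ W * (1 + b ^ 2) ^ (W \ K).card := by gcongr
        _ = G.potential θ W * (1 + b ^ 2) ^ ((W \ K).card + 1) := by ring
        _ ≤ G.potential θ W * (1 + b ^ 2) ^ W.card :=
          mul_le_mul_of_nonneg_left (pow_le_pow_right₀ hb1 (by omega)) hpot
    obtain ⟨𝒯, h𝒯, hdisj, hrest⟩ := ih (W \ K) (Finset.sdiff_ssubset hKW hKne) hpot'
    have hKdisj : ∀ L ∈ 𝒯, Disjoint K L := fun L hL =>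
      (Finset.disjoint_sdiff).mono_right (mem_nearCliques.1 (h𝒯 L hL)).1.1
    have hK𝒯 : K ∉ 𝒯 := fun h => hKne.ne_empty (disjoint_self.1 (hKdisj K h))
    refine ⟨insert K 𝒯, fun L hL => ?_, ?_, ?_⟩
    · rcases Finset.mem_insert.1 hL with rfl | hL
      · exact hK
      · have hL' := mem_nearCliques.1 (h𝒯 L hL)
        exact mem_nearCliques.2 ⟨⟨hL'.1.1.trans sdiff_subset, hL'.1.2⟩, hL'.2⟩
    · rw [Finset.coe_insert]
      exact hdisj.insert fun L hL _ => hKdisj L hL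
    · rw [Finset.card_insert_of_notMem hK𝒯]
      have : (W.card : ℝ) = (W \ K).card + r := by rw [← hcard, hKr]; push_cast; ring
      rw [this]
      push_cast
      linarith

/-- Almost perfect tilings with near cliques, in terms of deficits. -/
theorem exists_disjoint_nearCliques [Fintype V] [DecidableEq V] (G : StdMultigraph V) {r : ℕ}
    (hr : 2 ≤ r) {η : ℝ} (hη : 0 < η) (hηr : η ≤ 1 / r) (hV : 1024 ≤ η ^ 12 * Fintype.card V)
    (hdef : ∀ v, (G.deficitTo v univ : ℝ) ≤ 2 * (1 / r - η) * Fintype.card V) :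
    ∃ 𝒯 : Finset (Finset V), (∀ K ∈ 𝒯, K.card = r ∧ G.IsNearClique K) ∧
      (𝒯 : Set (Finset V)).PairwiseDisjoint id ∧
      (Fintype.card V : ℝ) - r * 𝒯.card ≤ η * Fintype.card V := by
  set n : ℝ := (Fintype.card V : ℝ) with hn
  have hr0 : (2 : ℝ) ≤ r := by exact_mod_cast hr
  have hηr' : η * r ≤ 1 := by rwa [le_div_iff₀ (by linarith)] at hηr
  have hη2 : η ≤ 1 / 2 := by nlinarith
  have hη12 : 0 < η ^ 12 := by positivity
  have hn0 : 0 < n := by nlinarith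
  have hpow : ∀ k ≤ 12, η ^ 12 ≤ η ^ k := fun k hk =>
    pow_le_pow_of_le_one hη.le (by linarith) hk
  have hηn : 1024 ≤ η ^ 2 * n :=
    hV.trans (mul_le_mul_of_nonneg_right (hpow 2 (by norm_num)) hn0.le)
  have hrs : 2 * (r : ℝ) ≤ η * n := by
    refine le_of_mul_le_mul_left ?_ hη
    nlinarith
  -- With these choices the slack `exp (2ηθ) = exp (η⁶n/8)` splits into equal halves: one pays for
  -- the `n` summands of the potential, the other for the growth `(1 + b²)^n`.
  set θ : ℝ := η ^ 5 / 16 * n with hθ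
  have hθ0 : 0 < θ := by positivity
  set b : ℝ := η ^ 3 / 4 with hb
  have hb0 : 0 < b := by positivity
  have hη3 : η ^ 3 ≤ 1 := pow_le_one₀ hη.le (by linarith)
  have hθb : ∀ m : ℝ, η * n < m → θ * (2 * r) ≤ b * (m - r) := by
    intro m hm
    have h1 : η * n / 2 ≤ m - r := by linarith
    calc θ * (2 * r) = η ^ 4 * n / 8 * (η * r) := by rw [hθ]; ring
      _ ≤ η ^ 4 * n / 8 * 1 := mul_le_mul_of_nonneg_left hηr' (by positivity)
      _ = b * (η * n / 2) := by rw [hb]; ring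
      _ ≤ b * (m - r) := mul_le_mul_of_nonneg_left h1 hb0.le
  have hpot : G.potential θ univ * (1 + b ^ 2) ^ (univ : Finset V).card ≤
      Real.exp (θ * (2 / r)) := by
    have h1 : G.potential θ univ ≤ n * Real.exp (θ * (2 * (1 / r - η))) := by
      rw [hn, ← nsmul_eq_mul, ← card_univ]
      refine Finset.sum_le_card_nsmul _ _ _ fun v _ => Real.exp_le_exp.2 ?_
      refine mul_le_mul_of_nonneg_left ?_ hθ0.le
      rw [card_univ, div_le_iff₀ hn0]
      exact hdef v
    have h2 : (1 + b ^ 2) ^ (univ : Finset V).card ≤ Real.exp (n * b ^ 2) := by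
      rw [card_univ, hn, Real.exp_nat_mul]
      gcongr
      linarith [Real.add_one_le_exp (b ^ 2)]
    have h3 : n ≤ Real.exp (η ^ 6 * n / 16) := by
      set y := η ^ 6 * n / 32 with hy
      have e1 : y + 1 ≤ Real.exp y := Real.add_one_le_exp y
      have e2 : Real.exp (η ^ 6 * n / 16) = Real.exp y ^ 2 := by
        rw [← Real.exp_nat_mul]; congr 1; rw [hy]; push_cast; ring
      -- The exponent 12 and the constant 1024 in the bound on `n` come from squaring `η⁶n/32`.
      have e3 : n ≤ y ^ 2 := by
        have : y ^ 2 = (η ^ 12 * n) * n / 1024 := by rw [hy]; ring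
        rw [this]; nlinarith
      have e4 : 0 ≤ y := by positivity
      rw [e2]
      nlinarith
    have h4 : n * b ^ 2 ≤ η ^ 6 * n / 16 := by rw [hb]; ring_nf; rfl
    calc G.potential θ univ * (1 + b ^ 2) ^ (univ : Finset V).card
        ≤ (n * Real.exp (θ * (2 * (1 / r - η)))) * Real.exp (n * b ^ 2) := by gcongr
      _ ≤ (Real.exp (η ^ 6 * n / 16) * Real.exp (θ * (2 * (1 / r - η)))) *
          Real.exp (η ^ 6 * n / 16) := by gcongr
      _ = Real.exp (θ * (2 / r)) := by
        rw [← Real.exp_add, ← Real.exp_add]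
        congr 1
        rw [hθ]; ring
  obtain ⟨𝒯, h1, h2, h3⟩ := G.exists_disjoint_nearCliques_of_potential (by omega : 1 ≤ r) hθ0
    (by rw [hb]; linarith) (by linarith : (r : ℝ) ≤ η * n) hθb univ hpot
  exact ⟨𝒯, fun K hK => ⟨(mem_nearCliques.1 (h1 K hK)).1.2, (mem_nearCliques.1 (h1 K hK)).2⟩, h2,
    by rwa [card_univ] at h3⟩

end Greedy

/-! ### Near cliques as copies, and deficits as degrees -/

/-- Since 2 of the allowed deficit 3 goes to the vertex itself, each vertex misses at most one edge
to the others. Hence the pairs of deficit 1 form the matching `F`, and no pair has deficit 2. -/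
theorem exists_kbar_copy {V : Type*} [DecidableEq V] (G : StdMultigraph V) {r : ℕ} {K : Finset V}
    (hcard : K.card = r) (hK : G.IsNearClique K) :
    ∃ X ∈ KBar r, ∃ c : Copy X G, c.verts = K := by
  classical
  set f : Fin r ↪ V := (K.equivFinOfCardEq hcard).symm.toEmbedding.trans
    (Function.Embedding.subtype _) with hf
  have hmem : ∀ i, f i ∈ K := fun i => ((K.equivFinOfCardEq hcard).symm i).2
  have hsum : ∀ S ⊆ K, ∀ v ∈ K, v ∉ S → G.deficitTo v S ≤ 1 := by
    intro S hS v hv hvS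
    have h1 := hK v hv
    have h2 := G.deficitTo_mono v (insert_subset hv hS)
    rw [G.deficitTo_insert v hvS, G.deficit_self] at h2
    omega
  have hdef : ∀ i j, i ≠ j → G.deficit (f i) (f j) ≤ 1 := by
    intro i j hij
    have := hsum {f j} (by simpa using hmem j) (f i) (hmem i)
      (by simpa using fun h => hij (f.injective h))
    simpa [deficitTo] using this
  let F : SimpleGraph (Fin r) :=
    { Adj := fun i j => i ≠ j ∧ G.deficit (f i) (f j) = 1
      symm := ⟨fun i j h => ⟨h.1.symm, by rw [G.deficit_comm]; exact h.2⟩⟩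
      loopless := ⟨fun i h => h.1 rfl⟩ }
  refine ⟨(complete (Fin r)).removeLight F, ⟨F, fun x y z hxy hxz => ?_, rfl⟩,
    ⟨f, fun i j => ?_⟩, ?_⟩
  · by_contra hyz
    have := hsum {f y, f z} (by simp [insert_subset_iff, hmem]) (f x) (hmem x) (by
      simp only [mem_insert, mem_singleton, f.injective.eq_iff]
      exact fun h => h.elim hxy.1 hxz.1)
    rw [deficitTo, sum_pair fun h => hyz (f.injective h), hxy.2, hxz.2] at this
    omega
  · by_cases hij : i = j
    · simp [removeLight, complete, hij]
    · have h := hdef i j hij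
      have h' : G.deficit (f i) (f j) = 2 - G.mult (f i) (f j) := rfl
      by_cases h1 : G.deficit (f i) (f j) = 1
      · have hF : F.Adj i j := ⟨hij, h1⟩
        simp only [removeLight, complete, if_neg hij, if_pos hF]
        omega
      · have hF : ¬F.Adj i j := fun h => h1 h.2
        simp only [removeLight, complete, if_neg hij, if_neg hF]
        omega
  · ext v
    simp only [Copy.verts, Set.mem_range, Finset.mem_coe]
    refine ⟨fun ⟨i, hi⟩ => hi ▸ hmem i, fun hv => ⟨K.equivFinOfCardEq hcard ⟨v, hv⟩, ?_⟩⟩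
    simp [hf]

/-- A finite collection of disjoint near cliques is a tiling. -/
theorem exists_tiling {V : Type*} [DecidableEq V] (G : StdMultigraph V) {r : ℕ}
    (𝒯 : Finset (Finset V)) (h𝒯 : ∀ K ∈ 𝒯, K.card = r ∧ G.IsNearClique K)
    (hdisj : (𝒯 : Set (Finset V)).PairwiseDisjoint id) :
    ∃ T : Tiling (KBar r) G, T.covered = (𝒯.biUnion id : Finset V) := by
  set e := 𝒯.equivFin
  have h : ∀ i : Fin 𝒯.card, ∃ X ∈ KBar r, ∃ c : Copy X G, c.verts = ((e.symm i).1 : Finset V) :=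
    fun i => G.exists_kbar_copy (h𝒯 _ (e.symm i).2).1 (h𝒯 _ (e.symm i).2).2
  choose X hX c hc using h
  refine ⟨⟨𝒯.card, X, hX, c, fun i j hij => ?_⟩, ?_⟩
  · rw [hc, hc, Finset.disjoint_coe]
    exact hdisj (e.symm i).2 (e.symm j).2 fun h => hij (e.symm.injective (Subtype.ext h))
  · ext v
    simp only [Tiling.covered, hc, Set.mem_iUnion, coe_biUnion, Finset.mem_coe, id]
    constructor
    · rintro ⟨i, hi⟩
      exact ⟨_, (e.symm i).2, hi⟩
    · rintro ⟨K, hK, hv⟩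
      exact ⟨e ⟨K, hK⟩, by simpa using hv⟩

theorem exists_tiling_ncard {V : Type*} [Fintype V] [DecidableEq V] (G : StdMultigraph V) {r : ℕ}
    (𝒯 : Finset (Finset V)) (h𝒯 : ∀ K ∈ 𝒯, K.card = r ∧ G.IsNearClique K)
    (hdisj : (𝒯 : Set (Finset V)).PairwiseDisjoint id) :
    ∃ T : Tiling (KBar r) G,
      ((T.coveredᶜ).ncard : ℝ) = (Fintype.card V : ℝ) - r * 𝒯.card := by
  obtain ⟨T, hT⟩ := G.exists_tiling 𝒯 h𝒯 hdisj
  refine ⟨T, ?_⟩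
  have h1 : (𝒯.biUnion id).card = 𝒯.card * r := by
    rw [Finset.card_biUnion hdisj]
    exact Finset.sum_const_nat fun K hK => (h𝒯 K hK).1
  have h2 := Finset.card_compl_add_card (𝒯.biUnion id)
  rw [hT, ← Finset.coe_compl, Set.ncard_coe_finset, ← h2, h1]
  push_cast
  ring

theorem deficitTo_univ_add_degree {V : Type*} [Fintype V] (G : StdMultigraph V) (v : V) :
    G.deficitTo v univ + G.degree v = 2 * Fintype.card V := by
  rw [deficitTo, degree, ← Finset.sum_add_distrib, mul_comm, ← smul_eq_mul]
  refine Finset.sum_const_nat fun u _ => ?_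
  exact Nat.sub_add_cancel (G.mult_le_two v u)

theorem deficitTo_univ_le {V : Type*} [Fintype V] (G : StdMultigraph V) {a : ℝ}
    (h : 2 * (1 - a) * (Fintype.card V : ℝ) ≤ G.minDegree) (v : V) :
    (G.deficitTo v univ : ℝ) ≤ 2 * a * Fintype.card V := by
  have h1 : G.minDegree ≤ G.degree v := ciInf_le (OrderBot.bddBelow _) v
  have h2 : (G.minDegree : ℝ) ≤ G.degree v := by exact_mod_cast h1
  have h3 : (G.deficitTo v univ : ℝ) + G.degree v = 2 * Fintype.card V := by
    exact_mod_cast G.deficitTo_univ_add_degree v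
  linarith

/-! ### Adding universal vertices -/

open scoped Classical in
/-- Add the vertices of `U` to `G`, joined by heavy edges to all other vertices. -/
noncomputable def addUniversal {V : Type*} (G : StdMultigraph V) (U : Type*) :
    StdMultigraph (V ⊕ U) where
  mult x y := Sum.elim (fun a => Sum.elim (fun b => G.mult a b) (fun _ => 2) y)
    (fun _ => if x = y then 0 else 2) x
  symm x y := by
    rcases x with a | a <;> rcases y with b | b <;> simp [G.symm, eq_comm]
  loopless x := by rcases x with a | a <;> simp [G.loopless]
  mult_le_two x y := by
    rcases x with a | a <;> rcases y with b | b <;> simp [G.mult_le_two]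
    split_ifs <;> omega

/-- Absolute deficits do not change while the vertex set grows, so relative deficits fall; this is
the gain from universal vertices. -/
theorem addUniversal_deficitTo_inl {V U : Type*} [Fintype V] [Fintype U] (G : StdMultigraph V)
    (a : V) : (G.addUniversal U).deficitTo (Sum.inl a) univ = G.deficitTo a univ := by
  rw [deficitTo, Fintype.sum_sum_type]
  simp [deficitTo, deficit, addUniversal]

theorem addUniversal_deficitTo_inr {V U : Type*} [Fintype V] [Fintype U] (G : StdMultigraph V)
    (a : U) : (G.addUniversal U).deficitTo (Sum.inr a) univ = 2 := by
  classical
  rw [deficitTo, Finset.sum_eq_single (Sum.inr a), deficit_self]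
  · intro y _ hy
    simp [deficit, addUniversal, hy.symm]
  · simp

/-- Discarding the tiles that meet `U` from a tiling of `G.addUniversal U`. -/
theorem exists_disjoint_of_addUniversal {V U : Type*} [Fintype U] [DecidableEq V] [DecidableEq U]
    (G : StdMultigraph V) {r : ℕ} (𝒯 : Finset (Finset (V ⊕ U)))
    (h𝒯 : ∀ K ∈ 𝒯, K.card = r ∧ (G.addUniversal U).IsNearClique K)
    (hdisj : (𝒯 : Set (Finset (V ⊕ U))).PairwiseDisjoint id) :
    ∃ 𝒮 : Finset (Finset V), (∀ K ∈ 𝒮, K.card = r ∧ G.IsNearClique K) ∧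
      (𝒮 : Set (Finset V)).PairwiseDisjoint id ∧ 𝒯.card ≤ 𝒮.card + Fintype.card U := by
  have hmapinj : Function.Injective fun K : Finset V => K.map (Function.Embedding.inl (β := U)) :=
    Finset.map_injective _
  set 𝒮 : Finset (Finset V) := 𝒯.preimage (fun K => K.map Function.Embedding.inl)
    hmapinj.injOn with h𝒮
  have hmem : ∀ K, K ∈ 𝒮 ↔ K.map Function.Embedding.inl ∈ 𝒯 := fun K => by simp [h𝒮]
  refine ⟨𝒮, fun K hK => ?_, fun K hK L hL hKL => ?_, ?_⟩
  · obtain ⟨h1, h2⟩ := h𝒯 _ ((hmem K).1 hK)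
    rw [card_map] at h1
    refine ⟨h1, fun x hx => ?_⟩
    have := h2 (Sum.inl x) (by simpa using hx)
    rw [deficitTo, sum_map] at this
    exact this
  · have := hdisj ((hmem K).1 hK) ((hmem L).1 hL) (hmapinj.ne hKL)
    exact (Finset.disjoint_map _).1 this
  · set 𝒩 := 𝒯.filter fun K => ∃ u : U, Sum.inr u ∈ K with h𝒩
    have h1 : 𝒩.card ≤ Fintype.card U := by
      rw [← card_univ]
      -- Tiles are disjoint, so each added vertex spoils at most one of them.
      refine Finset.card_le_card_of_forall_subsingleton (fun K u => Sum.inr u ∈ K)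
        (fun K hK => ?_) fun u _ K hK L hL => ?_
      · obtain ⟨u, hu⟩ := (mem_filter.1 hK).2
        exact ⟨u, mem_univ u, hu⟩
      · by_contra hne
        have hd := hdisj (mem_filter.1 hK.1).1 (mem_filter.1 hL.1).1 hne
        exact Finset.disjoint_left.1 hd hK.2 hL.2
    have h2 : 𝒯 ⊆ 𝒮.image (fun K => K.map Function.Embedding.inl) ∪ 𝒩 := by
      intro K hK
      by_cases hu : ∃ u : U, Sum.inr u ∈ K
      · exact mem_union_right _ (mem_filter.2 ⟨hK, hu⟩)
      · push Not at hu
        have hKeq : (K.preimage Sum.inl Sum.inl_injective.injOn).map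
            (Function.Embedding.inl (β := U)) = K := by
          ext (x | x)
          · simp
          · simp [hu x]
        refine mem_union_left _ (mem_image.2 ⟨_, (hmem _).2 ?_, hKeq⟩)
        rwa [hKeq]
    calc 𝒯.card ≤ _ := card_le_card h2
      _ ≤ _ := card_union_le _ _
      _ ≤ _ := add_le_add card_image_le h1

end StdMultigraph

/-! ### Constants and the final deduction -/

theorem isHierarchyBound_id : IsHierarchyBound fun x => x :=
  ⟨fun _ h => h, fun _ _ _ _ h => h⟩

theorem isHierarchyBound_quarter : IsHierarchyBound fun x => x / 4 :=
  ⟨fun _ h => by positivity, fun _ _ _ _ h => by simp only; linarith⟩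

theorem isHierarchyBound_pow : IsHierarchyBound fun x => x ^ 12 / 1024 :=
  ⟨fun _ h => by positivity, fun x hx y _ h => by
    have := pow_lt_pow_left₀ h (le_of_lt hx) (by norm_num : 12 ≠ 0)
    simp only; linarith⟩

theorem le_pow_mul_of_one_div_le {n : ℕ} (hn : 0 < n) {η : ℝ}
    (h : 1 / (n : ℝ) ≤ η ^ 12 / 1024) : 1024 ≤ η ^ 12 * n := by
  have hn' : (0 : ℝ) < n := by exact_mod_cast hn
  rw [div_le_div_iff₀ hn' (by norm_num)] at h
  linarith

theorem mainTheorem6 :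
    (∃ f g : ℝ → ℝ, IsHierarchyBound f ∧ IsHierarchyBound g ∧
      ∀ (r n : ℕ) (η : ℝ), 2 ≤ r → 0 < η → η ≤ f (1 / (r : ℝ)) → 0 < n → 1 / (n : ℝ) ≤ g η →
      ∀ (V : Type*) [Fintype V] (G : StdMultigraph V), Fintype.card V = n →
        2 * (1 - 1 / (r : ℝ) + η) * (n : ℝ) ≤ (G.minDegree : ℝ) →
        ∃ T : StdMultigraph.Tiling (StdMultigraph.KBar r) G,
          ((T.coveredᶜ).ncard : ℝ) ≤ η * (n : ℝ)) ∧
    (∃ f g : ℝ → ℝ, IsHierarchyBound f ∧ IsHierarchyBound g ∧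
      ∀ (r n : ℕ) (η : ℝ), 2 ≤ r → 0 < η → η ≤ f (1 / (r : ℝ)) → 0 < n → 1 / (n : ℝ) ≤ g η →
      ∀ (V : Type*) [Fintype V] (G : StdMultigraph V), Fintype.card V = n →
        2 * (1 - 1 / (r : ℝ) - η) * (n : ℝ) ≤ (G.minDegree : ℝ) →
        ∃ T : StdMultigraph.Tiling (StdMultigraph.KBar r) G,
          ((T.coveredᶜ).ncard : ℝ) ≤ 4 * (r : ℝ) ^ 2 * η * (n : ℝ)) := by
  classical
  refine ⟨⟨_, _, isHierarchyBound_id, isHierarchyBound_pow, ?_⟩,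
    ⟨_, _, isHierarchyBound_quarter, isHierarchyBound_pow, ?_⟩⟩
  · rintro r n η hr hη hηr hn hng V _ G rfl hG
    have hG' : 2 * (1 - (1 / (r : ℝ) - η)) * (Fintype.card V : ℝ) ≤ G.minDegree := by
      linarith
    obtain ⟨𝒯, h1, h2, h3⟩ := G.exists_disjoint_nearCliques hr hη hηr
      (le_pow_mul_of_one_div_le hn hng) (G.deficitTo_univ_le hG')
    obtain ⟨T, hT⟩ := G.exists_tiling_ncard 𝒯 h1 h2
    exact ⟨T, hT ▸ h3⟩
  · rintro r n η hr hη hηr hn hng V _ G rfl hG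
    have hG' : 2 * (1 - (1 / (r : ℝ) + η)) * (Fintype.card V : ℝ) ≤ G.minDegree := by
      linarith
    have hr0 : (2 : ℝ) ≤ r := by exact_mod_cast hr
    have hrinv : (r : ℝ) * (1 / r) = 1 := mul_one_div_cancel (by linarith)
    have hηr4 : 4 * (η * r) ≤ 1 := by nlinarith
    have hbig := le_pow_mul_of_one_div_le hn hng
    set n : ℝ := (Fintype.card V : ℝ) with hndef
    have hn0 : 0 < n := by rw [hndef]; exact_mod_cast hn
    have hη1 : η ≤ 1 := by nlinarith
    have hηn : 1024 ≤ η * n := hbig.trans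
      (mul_le_mul_of_nonneg_right (pow_le_of_le_one hη.le hη1 (by norm_num)) hn0.le)
    -- The new vertices must absorb a change of `2ηn` in the bound `(1/r - η)n`. As `η ≤ 1/(4r)`,
    -- each contributes at least `3/(4r)`, so `3rηn` of them give `9ηn/4`.
    set m : ℕ := ⌈3 * (r * (η * n))⌉₊ with hm
    have hm1 : 3 * (r * (η * n)) ≤ m := Nat.le_ceil _
    have hm2 : (m : ℝ) ≤ 4 * (r * (η * n)) := by
      have := Nat.ceil_lt_add_one (show 0 ≤ 3 * (r * (η * n)) by positivity)
      nlinarith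
    have hcard : (Fintype.card (V ⊕ Fin m) : ℝ) = n + m := by simp [hndef]
    have hdef : ∀ v, ((G.addUniversal (Fin m)).deficitTo v Finset.univ : ℝ) ≤
        2 * (1 / r - η) * Fintype.card (V ⊕ Fin m) := by
      have hgap : 3 / 4 * (1 / (r : ℝ)) ≤ 1 / r - η := by linarith
      have hkey : 2 * (1 / (r : ℝ) + η) * n ≤ 2 * (1 / r - η) * (n + m) := by
        have h1 : 3 / 4 * (1 / (r : ℝ)) * (3 * (r * (η * n))) ≤ (1 / r - η) * m :=
          mul_le_mul hgap hm1 (by positivity) (by linarith [show 0 < 1 / (r : ℝ) by positivity])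
        have h2 : 3 / 4 * (1 / (r : ℝ)) * (3 * (r * (η * n))) = 9 / 4 * (η * n) := by
          linear_combination 9 / 4 * (η * n) * hrinv
        linarith
      rw [hcard]
      rintro (v | v)
      · rw [StdMultigraph.addUniversal_deficitTo_inl]
        exact (G.deficitTo_univ_le hG' v).trans hkey
      · rw [StdMultigraph.addUniversal_deficitTo_inr]
        refine le_trans ?_ hkey
        push_cast
        nlinarith [show 0 < 1 / (r : ℝ) by positivity]
    obtain ⟨𝒯, h1, h2, h3⟩ := (G.addUniversal (Fin m)).exists_disjoint_nearCliques hr hη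
      (hηr.trans (by linarith [show 0 < 1 / (r : ℝ) by positivity]))
      (by rw [hcard]; nlinarith [pow_pos hη 12, (Nat.cast_nonneg m : (0 : ℝ) ≤ m)]) hdef
    obtain ⟨𝒮, g1, g2, g3⟩ := G.exists_disjoint_of_addUniversal 𝒯 h1 h2
    obtain ⟨T, hT⟩ := G.exists_tiling_ncard 𝒮 g1 g2
    refine ⟨T, ?_⟩
    have g4 : (𝒯.card : ℝ) ≤ 𝒮.card + m := by
      rw [Fintype.card_fin] at g3; exact_mod_cast g3
    rw [hT]
    rw [hcard] at h3
    -- The loss is at most `η(n + m)` from the tiling plus `(r - 1)m` from the discarded tiles, as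
    -- the added vertices do not count. With `m ≤ 4rηn ≤ n` this is at most `2ηn + 4r(r - 1)ηn ≤
    -- 4r²ηn`.
    have k1 : (r : ℝ) * 𝒯.card ≤ r * 𝒮.card + r * m := by nlinarith
    have k2 : (r - 1 : ℝ) * m ≤ (r - 1) * (4 * (r * (η * n))) :=
      mul_le_mul_of_nonneg_left hm2 (by linarith)
    have k3 : η * m ≤ η * n := by
      refine mul_le_mul_of_nonneg_left (hm2.trans ?_) hη.le
      nlinarith
    have k4 : 2 * (η * n) ≤ r * (η * n) := mul_le_mul_of_nonneg_right hr0 (by positivity)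
    linarith
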